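/- Let $k$ be a finite field of characteristic two, $V$ a $k$-vector space with $\dim_k V = 2n$, $n\ge 4$, and $q:V\to k$ a quadratic form whose polar form $B(x,y)=q(x+y)-q(x)-q(y)$ is nondegenerate. Let $\mathrm{Tr}:k\to\mathbb F_2$ be the trace, $\widehat q(x)=e^{2\pi i\,\mathrm{Tr}(q(x))/2}$, $\omega(x,y)=e^{2\pi i\,\mathrm{Tr}(B(x,y))/2}$ and $\widehat V=\mathrm{Hom}(V,\mathbb C^*)$. Let $\mathrm{Sp}_k(V,\omega_q)$ and $O_k(V,q)$ be the groups of $k$-linear automorphisms of $V$ preserving $B$ and $q$, and let $\Omega_k(V,q)\subset O_k(V,q)$ be the subgroup of elements with Dickson invariant zero, that is, of those acting trivially on the center of the even Clifford algebra of $q$. Let $\mathrm{Sp}(V,\omega)$ and $O(V,\widehat q)$ be the groups of automorphisms of the abelian group $V$ preserving $\omega$ and $\widehat q$. Given a normalized 2-cocycle $\alpha:V\times V\to\mathbb C^*$ with $\alpha(x,y)/\alpha(y,x)=\omega(x,y)$, let $A=\mathbb C_\alpha[V]$ be the twisted group algebra, with basis $(u_x)_{x\in V}$ and product $u_xu_y=\alpha(x,y)u_{x+y}$,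 on which $v\in V$ acts by $u_x\mapsto\omega(v,x)u_x$; then $\widehat V\cong\mathrm{Aut}_V(A)$ (the $V$-equivariant algebra automorphisms), where $\chi$ acts by $u_x\mapsto\chi(x)u_x$. Given a group $X$ of automorphisms of $V$ and, for each $g\in X$, a function $\eta_g:V\to\mathbb C^*$ such that $\alpha_g:u_x\mapsto\eta_g(x)u_{g(x)}$ is an algebra automorphism of $A$, with $\eta_1=1$, the crossed product $\widehat V\#_\theta X$ is the set $\widehat V\times X$ with the product $(\chi,g)(\psi,h)=(\chi\cdot{}^g\psi\cdot\theta(g,h),gh)$, where ${}^g\psi=\alpha_g\psi\alpha_g^{-1}$ and $\theta(g,h)=\alpha_g\alpha_h\alpha_{gh}^{-1}$; it is an extension of $X$ by $\widehat V$. (a) Such $\alpha$ and $(\eta_g)_{g\in \mathrm{Sp}(V,\omega)}$ exist. For any such choice, let $\mathrm{APs}_k(V)=\widehat V\#_\theta \mathrm{Sp}_k(V,\omega_q)$ be the restriction of $\widehat V\#_\theta\mathrm{Sp}(V,\omega)$ to $\mathrm{Sp}_k(V,\omega_q)$. (b) There exist a bicharacter $b:V\times V\to\mathbb C^*$ with $b(x,x)=\widehat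 q(x)$ (so that $\alpha=b$ is as above) and, for $\alpha=b$, functions $(\eta_g)_{g\in O(V,\widehat q)}$ as above with $\eta_g(0)=1$, with values in $\{\pm1\}$, with $\eta_g(x+x)=\eta_g(x)^2$ and with $\eta_g(x)\eta_g(y)/\eta_g(x+y)$ a bicharacter. For any such choice, let $\mathrm{Ps}_k(V,q)=\widehat V\#_\theta O_k(V,q)$ and $\widehat V\#_\theta\Omega_k(V,q)$ be the restrictions of $\widehat V\#_\theta O(V,\widehat q)$. Then, for all such choices, none of the three exact sequences $$0\to \widehat{V}\to \mathrm{APs}_k(V)\to \mathrm{Sp}_k(V,\omega_q)\to 1,$$ $$0\to \widehat{V}\to \mathrm{Ps}_k(V,q)\to O_k(V,q)\to 1,$$ $$0\to \widehat{V}\to \widehat{V}\#_{\theta}\Omega_k(V,q)\to \Omega_k(V,q)\to 1$$ splits. -/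

import Mathlib

namespace PseudoSymplectic

noncomputable section

/-! ### Crossed products of groups -/

/-- An `X`-crossed system over `N`: maps `(x, n) ↦ ˣn` and `θ : X × X → N` for which
`(n, x)(m, y) = (n (ˣm) θ(x, y), xy)` is a group law on `N × X` with unit `(1, 1)`. -/
structure CrossedSystem (X N : Type*) [Group X] [Group N] where
  act : X → N → N
  θ : X → X → N
  act_mul : ∀ x n m, act x (n * m) = act x n * act x m
  θ_act : ∀ x y n, θ x y * act (x * y) n = act x (act y n) * θ x y
  θ_assoc : ∀ x y z, θ x y * θ (x * y) z = act x (θ y z) * θ x (y * z)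
  θ_one_right : ∀ x, θ x 1 = 1
  θ_one_left : ∀ x, θ 1 x = 1
  act_one : ∀ n, act 1 n = n

namespace CrossedSystem

variable {X Y N M : Type*} [Group X] [Group Y] [Group N] [Group M]

/-- The crossed product `N #_θ X`. -/
@[ext]
structure Product (S : CrossedSystem X N) where
  fst : N
  snd : X

variable (S : CrossedSystem X N)

theorem act_map_one (x : X) : S.act x 1 = 1 := by
  have h := S.act_mul x 1 1
  rw [one_mul] at h
  exact left_eq_mul.mp h

instance : Mul S.Product :=
  ⟨fun a b => ⟨a.fst * S.act a.snd b.fst * S.θ a.snd b.snd, a.snd * b.snd⟩⟩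

instance : One S.Product := ⟨⟨1, 1⟩⟩

instance : Inv S.Product :=
  ⟨fun a => ⟨(S.θ a.snd⁻¹ a.snd)⁻¹ * (S.act a.snd⁻¹ a.fst)⁻¹, a.snd⁻¹⟩⟩

theorem mul_def (a b : S.Product) :
    a * b = ⟨a.fst * S.act a.snd b.fst * S.θ a.snd b.snd, a.snd * b.snd⟩ := rfl

theorem one_def : (1 : S.Product) = ⟨1, 1⟩ := rfl

theorem inv_def (a : S.Product) :
    a⁻¹ = ⟨(S.θ a.snd⁻¹ a.snd)⁻¹ * (S.act a.snd⁻¹ a.fst)⁻¹, a.snd⁻¹⟩ := rfl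

instance : Group S.Product :=
  Group.ofLeftAxioms
    (by
      rintro ⟨a, x⟩ ⟨b, y⟩ ⟨c, z⟩
      simp only [mul_def, Product.mk.injEq, mul_assoc, and_true, S.act_mul]
      congr 2
      rw [← S.θ_assoc, ← mul_assoc, S.θ_act, mul_assoc])
    (by
      rintro ⟨a, x⟩
      simp [mul_def, one_def, S.act_one, S.θ_one_left])
    (by
      rintro ⟨a, x⟩
      have h := S.θ_act x⁻¹ x
      have h0 := S.act_mul x⁻¹
      simp only [mul_def, one_def, inv_def, Product.mk.injEq, inv_mul_cancel, and_true]
      group)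

/-- The exact sequence `1 → N → N #_θ X → X → 1`, `n ↦ (n, 1)`, `(n, x) ↦ x`. -/
def extension : GroupExtension N S.Product X where
  inl :=
    { toFun := fun n => ⟨n, 1⟩
      map_one' := rfl
      map_mul' := fun a b => by simp [mul_def, S.act_one, S.θ_one_left] }
  rightHom :=
    { toFun := fun a => a.snd
      map_one' := rfl
      map_mul' := fun _ _ => rfl }
  inl_injective := fun a b h => congrArg Product.fst h
  range_inl_eq_ker_rightHom := by
    ext ⟨n, x⟩
    constructor
    · rintro ⟨m, hm⟩
      exact (congrArg Product.snd hm).symm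
    · intro h
      exact ⟨n, Product.ext rfl (Eq.symm h)⟩
  rightHom_surjective := fun x => ⟨⟨1, x⟩, rfl⟩

/-- The restriction of a crossed system along a homomorphism `Y → X` (below: the inclusion of a
group `Y` into `X`), so that `N #_θ Y ⊆ N #_θ X`. -/
def comap (f : Y →* X) : CrossedSystem Y N where
  act y n := S.act (f y) n
  θ y z := S.θ (f y) (f z)
  act_mul _ _ _ := S.act_mul _ _ _
  θ_act _ _ _ := by rw [map_mul]; exact S.θ_act _ _ _
  θ_assoc _ _ _ := by simp only [map_mul]; exact S.θ_assoc _ _ _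
  θ_one_right _ := by rw [map_one]; exact S.θ_one_right _
  θ_one_left _ := by rw [map_one]; exact S.θ_one_left _
  act_one _ := by rw [map_one]; exact S.act_one _

/-- Transport of a crossed system along an isomorphism of the normal subgroup. -/
def congr (e : M ≃* N) : CrossedSystem X M where
  act x m := e.symm (S.act x (e m))
  θ x y := e.symm (S.θ x y)
  act_mul _ _ _ := by simp [S.act_mul]
  θ_act _ _ _ := by simp [← map_mul, S.θ_act]
  θ_assoc _ _ _ := by simp [← map_mul, S.θ_assoc]
  θ_one_right _ := by simp [S.θ_one_right]
  θ_one_left _ := by simp [S.θ_one_left]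
  act_one _ := by simp [S.act_one]

end CrossedSystem

/-! ### Twisted group algebras -/

section Twisted

variable {V : Type*} [AddCommGroup V]

/-- `Aut(V)`, the group of automorphisms of the abelian group `V` (written as `ℤ`-linear
automorphisms, the product being composition). -/
abbrev AutGrp (V : Type*) [AddCommGroup V] : Type _ := V ≃ₗ[ℤ] V

/-- Normalized 2-cocycles on the abelian group `V` with values in the trivial module `ℂˣ`. -/
structure Cocycle (V : Type*) [AddCommGroup V] where
  toFun : V → V → ℂˣ
  zero_left : ∀ x, toFun 0 x = 1
  zero_right : ∀ x, toFun x 0 = 1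
  cocycle : ∀ x y z, toFun x y * toFun (x + y) z = toFun y z * toFun x (y + z)

namespace Cocycle

instance : CoeFun (Cocycle V) (fun _ => V → V → ℂˣ) := ⟨Cocycle.toFun⟩

/-- `Alt(α)(x, y) = α(x, y) / α(y, x)`. -/
def alt (α : Cocycle V) (x y : V) : ℂˣ := α x y / α y x

/-- `α` is nondegenerate if `0` is the only `α`-regular element. -/
def Nondegenerate (α : Cocycle V) : Prop := ∀ x, (∀ y, α x y = α y x) → x = 0

theorem alt_add_right (α : Cocycle V) (v x y : V) :
    α.alt v (x + y) = α.alt v x * α.alt v y := by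
  have h1 := α.cocycle v x y
  have h2 := α.cocycle x y v
  have h3 := α.cocycle x v y
  rw [add_comm x v] at h3
  rw [add_comm y v] at h2
  simp only [alt]
  rw [div_mul_div_comm, div_eq_div_iff_mul_eq_mul]
  apply mul_left_cancel (a := α x y * α (v + x) y)
  calc α x y * α (v + x) y * (α v (x + y) * (α x v * α y v))
      = (α x y * α v (x + y)) * (α x v * α (v + x) y) * α y v := by
        simp only [mul_assoc, mul_comm, mul_left_comm]
    _ = (α v x * α (v + x) y) * (α v y * α x (v + y)) * α y v := by rw [h1, h3]
    _ = (α v x * α (v + x) y) * α v y * (α y v * α x (v + y)) := by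
        simp only [mul_assoc, mul_comm, mul_left_comm]
    _ = (α v x * α (v + x) y) * α v y * (α x y * α (x + y) v) := by rw [h2]
    _ = _ := by simp only [mul_assoc, mul_comm, mul_left_comm]

/-- The twisted group algebra `ℂ_α[V]`, with basis `u_x`, `x ∈ V`. -/
def Alg (_α : Cocycle V) : Type _ := V →₀ ℂ

variable (α : Cocycle V)

instance : AddCommGroup α.Alg := inferInstanceAs (AddCommGroup (V →₀ ℂ))

instance : Module ℂ α.Alg := inferInstanceAs (Module ℂ (V →₀ ℂ))

/-- The basis of `ℂ_α[V]`. -/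
def basis : Module.Basis V ℂ α.Alg := Module.Basis.ofRepr (LinearEquiv.refl ℂ (V →₀ ℂ))

/-- The basis element `u_x`. -/
def u (x : V) : α.Alg := α.basis x

/-- The bilinear multiplication with `u_x u_y = α(x, y) u_{x + y}`. -/
def mulLin : α.Alg →ₗ[ℂ] α.Alg →ₗ[ℂ] α.Alg :=
  α.basis.constr ℂ fun x => α.basis.constr ℂ fun y => (α x y : ℂ) • α.u (x + y)

theorem mulLin_u (x y : V) : α.mulLin (α.u x) (α.u y) = (α x y : ℂ) • α.u (x + y) := by
  simp [mulLin, u]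

instance : Mul α.Alg := ⟨fun a b => α.mulLin a b⟩

instance : One α.Alg := ⟨α.u 0⟩

theorem mul_eq (a b : α.Alg) : a * b = α.mulLin a b := rfl

theorem one_eq : (1 : α.Alg) = α.u 0 := rfl

theorem u_mul_u (x y : V) : α.u x * α.u y = (α x y : ℂ) • α.u (x + y) := α.mulLin_u x y

theorem span_u : Submodule.span ℂ (Set.range α.u) = ⊤ := α.basis.span_eq

@[elab_as_elim]
theorem induction {p : α.Alg → Prop} (hu : ∀ x, p (α.u x)) (hz : p 0)
    (hadd : ∀ a b, p a → p b → p (a + b)) (hsmul : ∀ (c : ℂ) a, p a → p (c • a))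
    (a : α.Alg) : p a := by
  have ha : a ∈ Submodule.span ℂ (Set.range α.u) := by rw [span_u]; trivial
  induction ha using Submodule.span_induction with
  | mem x hx => obtain ⟨y, rfl⟩ := hx; exact hu y
  | zero => exact hz
  | add a b _ _ h1 h2 => exact hadd a b h1 h2
  | smul c a _ h => exact hsmul c a h

theorem one_mul_aux (a : α.Alg) : 1 * a = a := by
  rw [mul_eq, one_eq]
  refine α.induction (fun x => ?_) ?_ (fun a b ha hb => ?_) (fun c a ha => ?_) a
  · simp [mulLin_u, α.zero_left]
  · simp
  · rw [map_add, ha, hb]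
  · rw [map_smul, ha]

theorem mul_one_aux (a : α.Alg) : a * 1 = a := by
  rw [mul_eq, one_eq]
  refine α.induction (fun x => ?_) ?_ (fun a b ha hb => ?_) (fun c a ha => ?_) a
  · simp [mulLin_u, α.zero_right]
  · simp
  · rw [map_add, LinearMap.add_apply, ha, hb]
  · rw [map_smul, LinearMap.smul_apply, ha]

theorem mul_assoc_aux (a b c : α.Alg) : a * b * c = a * (b * c) := by
  simp only [mul_eq]
  refine α.induction (fun x => ?_) ?_ (fun a a' ha hb => ?_) (fun r a ha => ?_) a
  · refine α.induction (fun y => ?_) ?_ (fun a a' ha hb => ?_) (fun r a ha => ?_) b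
    · refine α.induction (fun z => ?_) ?_ (fun a a' ha hb => ?_) (fun r a ha => ?_) c
      · simp only [mulLin_u, map_smul, LinearMap.smul_apply, smul_smul, add_assoc,
          ← Units.val_mul, α.cocycle]
      · simp
      · simp only [map_add, ha, hb]
      · simp only [map_smul, ha]
    · simp
    · simp only [map_add, LinearMap.add_apply, ha, hb]
    · simp only [map_smul, LinearMap.smul_apply, ha]
  · simp
  · simp only [map_add, LinearMap.add_apply, ha, hb]
  · simp only [map_smul, LinearMap.smul_apply, ha]

instance : Ring α.Alg :=
  { (inferInstance : AddCommGroup α.Alg) with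
    mul := (· * ·)
    one := 1
    one_mul := α.one_mul_aux
    mul_one := α.mul_one_aux
    mul_assoc := α.mul_assoc_aux
    zero_mul := fun a => by simp [mul_eq]
    mul_zero := fun a => by simp [mul_eq]
    left_distrib := fun a b c => by simp [mul_eq]
    right_distrib := fun a b c => by simp [mul_eq] }

instance : Algebra ℂ α.Alg :=
  Algebra.ofModule (fun r a b => by simp [mul_eq]) (fun r a b => by simp [mul_eq])

/-- The action of `V` on the `V`-Galois algebra `ℂ_α[V]`: `v · u_x = Alt(α)(v, x) u_x`
(this is conjugation by `u_v`). -/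
def galois (v : V) : α.Alg →ₗ[ℂ] α.Alg :=
  α.basis.constr ℂ fun x => (α.alt v x : ℂ) • α.u x

theorem galois_u (v x : V) : α.galois v (α.u x) = (α.alt v x : ℂ) • α.u x := by
  simp [galois, u]

theorem linearMap_ext {W : Type*} [AddCommGroup W] [Module ℂ W] {f g : α.Alg →ₗ[ℂ] W}
    (h : ∀ x, f (α.u x) = g (α.u x)) : f = g := α.basis.ext h

theorem algEquiv_ext {f g : α.Alg ≃ₐ[ℂ] α.Alg} (h : ∀ x, f (α.u x) = g (α.u x)) :
    f = g := by
  ext a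
  exact LinearMap.congr_fun (α.linearMap_ext (f := f.toLinearMap) (g := g.toLinearMap) h) a

/-- `Aut_V(A)`, the group of `V`-equivariant algebra automorphisms of `A = ℂ_α[V]`. -/
def autV : Subgroup (α.Alg ≃ₐ[ℂ] α.Alg) where
  carrier := {f | ∀ v a, f (α.galois v a) = α.galois v (f a)}
  mul_mem' := fun {f g} hf hg v a => by
    rw [AlgEquiv.mul_apply, hg, hf, AlgEquiv.mul_apply]
  one_mem' := fun _ _ => rfl
  inv_mem' := fun {f} hf v a => by
    apply f.injective
    rw [hf]
    simp [AlgEquiv.aut_inv]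

theorem apply_inv (g : AutGrp V) (x : V) : g (g⁻¹ x) = x := LinearEquiv.apply_symm_apply g x

theorem inv_apply (g : AutGrp V) (x : V) : g⁻¹ (g x) = x := LinearEquiv.symm_apply_apply g x

/-- The linear map `u_x ↦ η(x) u_{g x}`. -/
def monomialLin (g : AutGrp V) (η : V → ℂˣ) : α.Alg →ₗ[ℂ] α.Alg :=
  α.basis.constr ℂ fun x => (η x : ℂ) • α.u (g x)

theorem monomialLin_u (g : AutGrp V) (η : V → ℂˣ) (x : V) :
    α.monomialLin g η (α.u x) = (η x : ℂ) • α.u (g x) := by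
  simp [monomialLin, u]

/-- The algebra endomorphism `u_x ↦ η(x) u_{g x}`. -/
def monomialHom (g : AutGrp V) (η : V → ℂˣ)
    (h : ∀ x y, α (g x) (g y) * (η x * η y) = α x y * η (x + y)) :
    α.Alg →ₐ[ℂ] α.Alg :=
  AlgHom.ofLinearMap (α.monomialLin g η)
    (by
      have h0 : η 0 = 1 := by
        have := h 0 0
        simpa [α.zero_left] using this
      rw [one_eq, monomialLin_u, h0, map_zero]
      simp)
    (by
      intro a b
      refine α.induction (fun x => ?_) ?_ (fun a a' ha hb => ?_) (fun r a ha => ?_) a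
      · refine α.induction (fun y => ?_) ?_ (fun a a' ha hb => ?_) (fun r a ha => ?_) b
        · rw [u_mul_u, map_smul, monomialLin_u, monomialLin_u, monomialLin_u, smul_mul_smul_comm,
            u_mul_u, smul_smul, smul_smul, map_add, ← Units.val_mul, ← Units.val_mul,
            ← Units.val_mul, ← h, mul_comm]
        · simp
        · simp only [mul_add, map_add, ha, hb]
        · simp only [mul_smul_comm, map_smul, ha]
      · simp
      · simp only [add_mul, map_add, ha, hb]
      · simp only [smul_mul_assoc, map_smul, ha])

/-- The algebra automorphism `u_x ↦ η(x) u_{g x}` of `ℂ_α[V]`; the hypothesis says that `α^g / α`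
is the coboundary of `η` (or of `η⁻¹`, depending on the sign convention for coboundaries). -/
def monomial (g : AutGrp V) (η : V → ℂˣ)
    (h : ∀ x y, α (g x) (g y) * (η x * η y) = α x y * η (x + y)) :
    α.Alg ≃ₐ[ℂ] α.Alg :=
  AlgEquiv.ofAlgHom (α.monomialHom g η h)
    (α.monomialHom g⁻¹ (fun x => (η (g⁻¹ x))⁻¹) (by
      intro x y
      have := h (g⁻¹ x) (g⁻¹ y)
      simp only [← map_add, apply_inv] at this
      rw [← mul_inv, mul_inv_eq_iff_eq_mul, mul_right_comm, this, mul_inv_cancel_right]))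
    (by
      apply AlgHom.toLinearMap_injective
      refine α.linearMap_ext fun x => ?_
      simp [monomialHom, monomialLin_u, smul_smul])
    (by
      apply AlgHom.toLinearMap_injective
      refine α.linearMap_ext fun x => ?_
      simp [monomialHom, monomialLin_u, smul_smul, inv_apply])

theorem monomial_u (g : AutGrp V) (η : V → ℂˣ)
    (h : ∀ x y, α (g x) (g y) * (η x * η y) = α x y * η (x + y)) (x : V) :
    α.monomial g η h (α.u x) = (η x : ℂ) • α.u (g x) := α.monomialLin_u g η x

/-- An element `χ` of the dual group `V̂ = Hom(V, ℂˣ)` acts on `ℂ_α[V]` by `u_x ↦ χ(x) u_x`. -/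
def diag (χ : AddChar V ℂˣ) : α.Alg ≃ₐ[ℂ] α.Alg :=
  α.monomial 1 χ (fun x y => by simp [AddChar.map_add_eq_mul])

theorem diag_u (χ : AddChar V ℂˣ) (x : V) : α.diag χ (α.u x) = (χ x : ℂ) • α.u x :=
  α.monomialLin_u 1 χ x

/-- The homomorphism `V̂ → Aut_V(A)`. -/
def dualHom : AddChar V ℂˣ →* α.autV where
  toFun χ := ⟨α.diag χ, by
    intro v a
    refine α.induction (fun x => ?_) ?_ (fun a a' ha hb => ?_) (fun r a ha => ?_) a
    · rw [galois_u, map_smul, diag_u, map_smul, galois_u, smul_comm]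
    · simp
    · simp only [map_add, ha, hb]
    · simp only [map_smul, ha]⟩
  map_one' := by
    apply Subtype.ext
    apply α.algEquiv_ext
    intro x
    simp [diag_u]
  map_mul' χ ψ := by
    apply Subtype.ext
    apply α.algEquiv_ext
    intro x
    simp [diag_u, smul_smul, mul_comm]

theorem u_ne_zero (x : V) : α.u x ≠ 0 := α.basis.ne_zero x

theorem smul_u_injective (x : V) {c d : ℂ} (h : c • α.u x = d • α.u x) : c = d :=
  smul_left_injective ℂ (α.u_ne_zero x) h

theorem repr_galois (v : V) (a : α.Alg) (y : V) :
    α.basis.repr (α.galois v a) y = (α.alt v y : ℂ) * α.basis.repr a y := by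
  refine α.induction (fun x => ?_) ?_ (fun a a' ha hb => ?_) (fun r a ha => ?_) a
  · rw [galois_u, map_smul, u, Module.Basis.repr_self, Finsupp.smul_apply, smul_eq_mul]
    by_cases h : x = y
    · rw [h]
    · simp [Finsupp.single_eq_of_ne' h]
  · simp
  · simp only [map_add, Finsupp.add_apply, ha, hb, mul_add]
  · simp only [map_smul, Finsupp.smul_apply, smul_eq_mul, ha]
    ring

theorem dualHom_injective : Function.Injective α.dualHom := by
  intro χ ψ h
  ext x
  have h1 : α.diag χ (α.u x) = α.diag ψ (α.u x) := by
    rw [show α.diag χ = α.diag ψ from congrArg Subtype.val h]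
  rw [diag_u, diag_u] at h1
  exact α.smul_u_injective x h1

theorem dualHom_surjective (hα : α.Nondegenerate) : Function.Surjective α.dualHom := by
  rintro ⟨f, hf⟩
  have key : ∀ x, ∃ c : ℂˣ, f (α.u x) = (c : ℂ) • α.u x := by
    intro x
    have h1 : f (α.u x) = (α.basis.repr (f (α.u x)) x) • α.u x := by
      apply α.basis.repr.injective
      ext y
      rw [map_smul, u, Module.Basis.repr_self, Finsupp.smul_apply, smul_eq_mul]
      by_cases h : x = y
      · rw [h]; simp
      · rw [Finsupp.single_eq_of_ne' h, mul_zero]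
        by_contra hne
        apply h
        have h2 : ∀ v, α.alt v x = α.alt v y := by
          intro v
          have h3 := hf v (α.u x)
          rw [galois_u, map_smul] at h3
          have h4 := congrArg (fun a => α.basis.repr a y) h3
          simp only [repr_galois, map_smul, Finsupp.smul_apply, smul_eq_mul] at h4
          exact Units.ext (mul_right_cancel₀ hne h4)
        have h5 : x - y = 0 := by
          apply hα
          intro v
          have h6 : α.alt v (x - y) = 1 := by
            have := α.alt_add_right v (x - y) y
            rw [sub_add_cancel, h2] at this
            exact right_eq_mul.mp this
          exact (div_eq_one.mp h6).symm
        exact sub_eq_zero.mp h5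
    have h0 : α.basis.repr (f (α.u x)) x ≠ 0 := by
      intro h0
      rw [h0, zero_smul] at h1
      exact α.u_ne_zero x (f.injective (h1.trans (map_zero f).symm))
    exact ⟨Units.mk0 _ h0, h1⟩
  choose c hc using key
  refine ⟨⟨c, ?_, ?_⟩, ?_⟩
  · have h1 := hc 0
    rw [← one_eq, map_one] at h1
    apply Units.ext
    apply α.smul_u_injective 0
    rw [← one_eq, ← h1]
    simp
  · intro x y
    have h1 : f (α.u x * α.u y) = f (α.u x) * f (α.u y) := map_mul f _ _
    rw [u_mul_u, map_smul, hc, hc, hc, smul_mul_smul_comm, u_mul_u, smul_smul, smul_smul] at h1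
    have h2 := α.smul_u_injective _ h1
    rw [mul_comm] at h2
    exact Units.ext (mul_right_cancel₀ (α x y).ne_zero (by simpa using h2))
  · apply Subtype.ext
    apply α.algEquiv_ext
    intro x
    exact (α.diag_u _ x).trans (hc x).symm

/-- `V̂ ≅ Aut_V(ℂ_α[V])` for nondegenerate `α`. -/
def dualEquiv (hα : α.Nondegenerate) : AddChar V ℂˣ ≃* α.autV :=
  MulEquiv.ofBijective α.dualHom ⟨α.dualHom_injective, α.dualHom_surjective hα⟩

/-- `f : A → A^{(g)}` is an isomorphism of `V`-algebras, where `A = ℂ_α[V]` and `A^{(g)}` is the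
algebra `A` on which `v ∈ V` acts as `g(v)` acts on `A`. -/
def IsTwistedIso (g : AutGrp V) (f : α.Alg ≃ₐ[ℂ] α.Alg) : Prop :=
  ∀ v a, f (α.galois v a) = α.galois (g v) (f a)

variable {α}

theorem IsTwistedIso.mul {g h : AutGrp V} {e f : α.Alg ≃ₐ[ℂ] α.Alg}
    (he : α.IsTwistedIso g e) (hf : α.IsTwistedIso h f) : α.IsTwistedIso (g * h) (e * f) := by
  intro v a
  rw [AlgEquiv.mul_apply, hf, he, AlgEquiv.mul_apply]
  rfl

theorem IsTwistedIso.inv {g : AutGrp V} {f : α.Alg ≃ₐ[ℂ] α.Alg}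
    (hf : α.IsTwistedIso g f) : α.IsTwistedIso g⁻¹ f⁻¹ := by
  intro v a
  apply f.injective
  rw [hf, apply_inv]
  simp [AlgEquiv.aut_inv]

theorem isTwistedIso_one_iff {f : α.Alg ≃ₐ[ℂ] α.Alg} :
    α.IsTwistedIso 1 f ↔ f ∈ α.autV := Iff.rfl

end Cocycle

/-- A choice, for every `g` in a group `H` of automorphisms of `V`, of a cochain `η_g` such that
`α_g : u_x ↦ η_g(x) u_{g x}` is an algebra automorphism of `ℂ_α[V]`, with `α_1 = id`. -/
structure LiftFamily (α : Cocycle V) (H : Subgroup (AutGrp V)) where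
  η : H → V → ℂˣ
  coboundary : ∀ (g : H) (x y : V),
    α (g.1 x) (g.1 y) * (η g x * η g y) = α x y * η g (x + y)
  η_one : ∀ x, η 1 x = 1

namespace LiftFamily

variable {α : Cocycle V} {H : Subgroup (AutGrp V)} (L : LiftFamily α H)

/-- The algebra automorphism `α_g : u_x ↦ η_g(x) u_{g x}`. -/
def lift (g : H) : α.Alg ≃ₐ[ℂ] α.Alg := α.monomial g.1 (L.η g) (L.coboundary g)

theorem lift_u (g : H) (x : V) : L.lift g (α.u x) = (L.η g x : ℂ) • α.u (g.1 x) :=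
  α.monomialLin_u g.1 (L.η g) x

theorem lift_one : L.lift 1 = 1 := by
  apply α.algEquiv_ext
  intro x
  rw [lift_u, L.η_one]
  simp

theorem alt_map (L : LiftFamily α H) (g : H) (x y : V) :
    α.alt (g.1 x) (g.1 y) = α.alt x y := by
  have h1 := L.coboundary g x y
  have h2 := L.coboundary g y x
  rw [add_comm y x, mul_comm (L.η g y)] at h2
  rw [← eq_mul_inv_iff_mul_eq] at h1 h2
  simp only [Cocycle.alt]
  rw [h1, h2, mul_div_mul_right_eq_div, mul_div_mul_right_eq_div]

theorem isTwistedIso_lift (g : H) : α.IsTwistedIso g.1 (L.lift g) := by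
  intro v a
  refine α.induction (fun x => ?_) ?_ (fun a a' ha hb => ?_) (fun r a ha => ?_) a
  · rw [α.galois_u, map_smul, lift_u, map_smul, α.galois_u, L.alt_map, smul_comm]
  · simp
  · simp only [map_add, ha, hb]
  · simp only [map_smul, ha]

/-- The crossed system of `H` over `Aut_V(A)`, `A = ℂ_α[V]`, given by `ᵍf = α_g f α_g⁻¹` and
`θ(g, h) = α_g α_h α_{gh}⁻¹`; the crossed product acts on `A` by `(f, g) · a = f(α_g(a))`. -/
def autSystem : CrossedSystem H α.autV where
  act g f := ⟨L.lift g * f.1 * (L.lift g)⁻¹, by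
    have h := ((L.isTwistedIso_lift g).mul (Cocycle.isTwistedIso_one_iff.mpr f.2)).mul
      (L.isTwistedIso_lift g).inv
    rwa [mul_one, mul_inv_cancel] at h⟩
  θ g h := ⟨L.lift g * L.lift h * (L.lift (g * h))⁻¹, by
    have h := ((L.isTwistedIso_lift g).mul (L.isTwistedIso_lift h)).mul
      (L.isTwistedIso_lift (g * h)).inv
    rwa [Subgroup.coe_mul, mul_inv_cancel] at h⟩
  act_mul g f e := Subtype.ext (by simp only [Subgroup.coe_mul]; group)
  θ_act g h f := Subtype.ext (by simp only [Subgroup.coe_mul]; group)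
  θ_assoc g h i := Subtype.ext (by simp only [Subgroup.coe_mul, mul_assoc]; group)
  θ_one_right g := Subtype.ext (by simp [lift_one])
  θ_one_left g := Subtype.ext (by simp [lift_one])
  act_one f := Subtype.ext (by simp [lift_one])

/-- The same crossed system, over `V̂ = Aut_V(A)`. -/
def weilSystem (hα : α.Nondegenerate) : CrossedSystem H (AddChar V ℂˣ) :=
  L.autSystem.congr (α.dualEquiv hα)

end LiftFamily

/-! ### Symplectic and quadratic modules -/

/-- The group `Sp(V, ω)` of a bicharacter `ω`. -/
def Sp (ω : V → V → ℂˣ) : Subgroup (AutGrp V) where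
  carrier := {g | ∀ x y, ω (g x) (g y) = ω x y}
  mul_mem' := fun {g h} hg hh x y => (hg (h x) (h y)).trans (hh x y)
  one_mem' := fun _ _ => rfl
  inv_mem' := fun {g} hg x y => by
    have h := hg (g⁻¹ x) (g⁻¹ y)
    rw [Cocycle.apply_inv, Cocycle.apply_inv] at h
    exact h.symm

/-- The group `O(V, Q)` of a quadratic form `Q : V → ℂˣ`. -/
def Orth (Q : V → ℂˣ) : Subgroup (AutGrp V) where
  carrier := {g | ∀ x, Q (g x) = Q x}
  mul_mem' := fun {g h} hg hh x => (hg (h x)).trans (hh x)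
  one_mem' := fun _ => rfl
  inv_mem' := fun {g} hg x => by
    have h := hg (g⁻¹ x)
    rw [Cocycle.apply_inv] at h
    exact h.symm

/-- `b : V × V → ℂˣ` is a bicharacter. -/
structure IsBicharacter (b : V → V → ℂˣ) : Prop where
  add_left : ∀ x y z, b (x + y) z = b x z * b y z
  add_right : ∀ x y z, b x (y + z) = b x y * b x z

/-- A bicharacter, regarded as a 2-cocycle. -/
def IsBicharacter.toCocycle {b : V → V → ℂˣ} (hb : IsBicharacter b) : Cocycle V where
  toFun := b
  zero_left x := by
    have h := hb.add_left 0 0 x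
    rw [add_zero] at h
    exact left_eq_mul.mp h
  zero_right x := by
    have h := hb.add_right x 0 0
    rw [add_zero] at h
    exact left_eq_mul.mp h
  cocycle x y z := by
    rw [hb.add_left, hb.add_right, ← mul_assoc, mul_comm (b x y), mul_comm (b x z), mul_right_comm]
    ac_rfl

/-- The group `C₀¹(V, μ_n)` of (normalized) maps `η : V → μ_n` whose coboundary is a bicharacter and
which satisfy `η(x + x) = η(x)²`. -/
structure IsC01 (n : ℕ) (η : V → ℂˣ) : Prop where
  zero : η 0 = 1
  pow : ∀ x, η x ^ n = 1
  bichar : IsBicharacter fun x y => η x * η y / η (x + y)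
  double : ∀ x, η (x + x) = η x ^ 2

/-- The choices that enter the affine pseudo-symplectic group `V̂ #_θ Sp(V, ω)` of `(V, ω)`:
a 2-cocycle `α` with `Alt(α) = ω`, and the cochains `η_g`, `g ∈ Sp(V, ω)`. -/
structure APsData (ω : V → V → ℂˣ) where
  α : Cocycle V
  alt_eq : ∀ x y, α.alt x y = ω x y
  lifts : LiftFamily α (Sp ω)

/-- The choices that enter the pseudo-symplectic group `V̂ #_θ O(V, Q)` of a quadratic module
`(V, Q)` of exponent `n`: a bicharacter `b` with `b(x, x) = Q(x)`, and the cochains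
`η_g ∈ C₀¹(V, μ_n)`, `g ∈ O(V, Q)`. -/
structure PsData (n : ℕ) (Q : V → ℂˣ) where
  b : V → V → ℂˣ
  bichar : IsBicharacter b
  b_self : ∀ x, b x x = Q x
  lifts : LiftFamily bichar.toCocycle (Orth Q)
  isC01 : ∀ g, IsC01 n (lifts.η g)

end Twisted

/-! ### Quadratic spaces over finite fields of characteristic two -/

section Quadratic

variable {k V : Type*} [Field k] [CharP k 2] [AddCommGroup V] [Module k V]

/-- The character `t ↦ exp(2πi Tr(t) / 2)` of `k`, where `Tr : k → 𝔽₂` is the trace. -/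
def traceChar (k : Type*) [Field k] [CharP k 2] : AddChar k ℂˣ :=
  letI := ZMod.algebra k 2
  Circle.toUnits.compAddChar
    ((ZMod.toCircle (N := 2)).compAddMonoidHom (Algebra.trace (ZMod 2) k).toAddMonoidHom)

/-- The quadratic form `q̂(v) = exp(2πi Tr(q(v)) / 2)` on the abelian group `V`. -/
def qHat (q : QuadraticForm k V) (x : V) : ℂˣ := traceChar k (q x)

/-- The skew-symmetric form `ω(v, w) = exp(2πi Tr(B(v, w)) / 2)` on the abelian group `V`, where
`B(v, w) = q(v + w) - q(v) - q(w)`. -/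
def omega (q : QuadraticForm k V) (x y : V) : ℂˣ := traceChar k (QuadraticMap.polar q x y)

end Quadratic

section Linear

variable {k V : Type*} [Field k] [AddCommGroup V] [Module k V] (q : QuadraticForm k V)

/-- The linear symplectic group `Sp_k(V)` of the bilinear form associated with `q`. -/
def SpLin : Subgroup (V ≃ₗ[k] V) where
  carrier := {g | ∀ x y, QuadraticMap.polar q (g x) (g y) = QuadraticMap.polar q x y}
  mul_mem' := fun {g h} hg hh x y => (hg (h x) (h y)).trans (hh x y)
  one_mem' := fun _ _ => rfl
  inv_mem' := fun {g} hg x y => by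
    have h := hg (g.symm x) (g.symm y)
    rw [LinearEquiv.apply_symm_apply, LinearEquiv.apply_symm_apply] at h
    exact h.symm

/-- The linear orthogonal group `O_k(V, q)`. -/
def OrthLin : Subgroup (V ≃ₗ[k] V) where
  carrier := {g | ∀ x, q (g x) = q x}
  mul_mem' := fun {g h} hg hh x => (hg (h x)).trans (hh x)
  one_mem' := fun _ => rfl
  inv_mem' := fun {g} hg x => by
    have h := hg (g.symm x)
    rw [LinearEquiv.apply_symm_apply] at h
    exact h.symm

variable {q}

/-- The automorphism of the Clifford algebra of `q` induced by `g ∈ O_k(V, q)`. -/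
def cliffordMap (g : OrthLin q) : CliffordAlgebra q →ₐ[k] CliffordAlgebra q :=
  CliffordAlgebra.map (⟨g.1.toLinearMap, g.2⟩ : q →qᵢ q)

theorem cliffordMap_mul (g h : OrthLin q) :
    cliffordMap (g * h) = (cliffordMap g).comp (cliffordMap h) := by
  rw [cliffordMap, cliffordMap, cliffordMap, CliffordAlgebra.map_comp_map]
  rfl

theorem cliffordMap_one : cliffordMap (1 : OrthLin q) = AlgHom.id k _ :=
  CliffordAlgebra.map_id q

open Classical in
/-- The Dickson invariant of `g ∈ O_k(V, q)`: it is `0` if `g` acts trivially on the center of the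
even Clifford algebra (a quadratic étale algebra over `k` if the polar form of `q` is
nondegenerate and `dim V > 0` is even), and `1` otherwise. -/
def dickson (g : OrthLin q) : ZMod 2 :=
  if ∀ z ∈ CliffordAlgebra.even q, (∀ y ∈ CliffordAlgebra.even q, y * z = z * y) →
    cliffordMap g z = z then 0 else 1

theorem dickson_eq_zero_iff (g : OrthLin q) :
    dickson g = 0 ↔ ∀ z ∈ CliffordAlgebra.even q,
      (∀ y ∈ CliffordAlgebra.even q, y * z = z * y) → cliffordMap g z = z := by
  unfold dickson
  split_ifs with h
  · exact iff_of_true rfl h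
  · exact iff_of_false one_ne_zero h

variable (q)

/-- `Ω_k(V, q)`, the subgroup of `O_k(V, q)` of the elements with Dickson invariant zero. -/
def OmegaLin : Subgroup (OrthLin q) where
  carrier := {g | dickson g = 0}
  mul_mem' := fun {g h} hg hh => by
    rw [Set.mem_ofPred_eq, dickson_eq_zero_iff] at *
    intro z hz hc
    rw [cliffordMap_mul, AlgHom.comp_apply, hh z hz hc, hg z hz hc]
  one_mem' := by
    rw [Set.mem_ofPred_eq, dickson_eq_zero_iff]
    intro z _ _
    rw [cliffordMap_one, AlgHom.id_apply]
  inv_mem' := fun {g} hg => by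
    rw [Set.mem_ofPred_eq, dickson_eq_zero_iff] at *
    intro z hz hc
    conv_lhs => rw [← hg z hz hc]
    rw [← AlgHom.comp_apply, ← cliffordMap_mul, inv_mul_cancel, cliffordMap_one, AlgHom.id_apply]

end Linear

section Extensions

variable {k V : Type*} [Field k] [CharP k 2] [AddCommGroup V] [Module k V]
  (q : QuadraticForm k V)

/-- The inclusion `Sp_k(V) → Sp(V, ω)`. -/
def spIncl : SpLin q →* Sp (omega q) where
  toFun g := ⟨g.1.restrictScalars ℤ, fun x y => congrArg (traceChar k) (g.2 x y)⟩
  map_one' := rfl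
  map_mul' _ _ := rfl

/-- The inclusion `O_k(V, q) → O(V, q̂)`. -/
def orthIncl : OrthLin q →* Orth (qHat q) where
  toFun g := ⟨g.1.restrictScalars ℤ, fun x => congrArg (traceChar k) (g.2 x)⟩
  map_one' := rfl
  map_mul' _ _ := rfl

variable {q}

theorem traceChar_eq_one_iff (t : k) :
    letI := ZMod.algebra k 2
    traceChar k t = 1 ↔ Algebra.trace (ZMod 2) k t = 0 := by
  let _ := ZMod.algebra k 2
  constructor
  · intro h
    apply ZMod.injective_toCircle
    rw [AddChar.map_zero_eq_one]
    apply Circle.ext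
    exact congrArg Units.val h
  · intro h
    apply Units.ext
    change ((ZMod.toCircle (Algebra.trace (ZMod 2) k t) : Circle) : ℂ) = 1
    rw [h, AddChar.map_zero_eq_one]
    rfl

theorem omega_nondegenerate [Finite k] (hq : (QuadraticMap.polarBilin q).Nondegenerate) (x : V)
    (h : ∀ y, omega q x y = 1) : x = 0 := by
  let _ := ZMod.algebra k 2
  apply hq.1
  intro y
  by_contra hne
  obtain ⟨c, hc⟩ := Algebra.trace_surjective (ZMod 2) k 1
  have h1 := (traceChar_eq_one_iff _).mp (h ((c / QuadraticMap.polar q x y) • y))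
  have h2 : QuadraticMap.polar q x y ≠ 0 := hne
  rw [QuadraticMap.polar_smul_right, smul_eq_mul, div_mul_cancel₀ _ h2, hc] at h1
  exact one_ne_zero h1

theorem APsData.nondegenerate [Finite k] (hq : (QuadraticMap.polarBilin q).Nondegenerate)
    (D : APsData (omega q)) : D.α.Nondegenerate := by
  intro x h
  apply omega_nondegenerate hq
  intro y
  rw [← D.alt_eq, Cocycle.alt, h, div_self']

theorem PsData.alt_eq (D : PsData 2 (qHat q)) (x y : V) :
    D.bichar.toCocycle.alt x y = omega q x y := by
  have h2 : D.b y x * D.b y x = 1 := by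
    have h0 : y + y = 0 := by
      rw [← two_smul k y, CharTwo.two_eq_zero, zero_smul]
    rw [← D.bichar.add_left, h0]
    exact D.bichar.toCocycle.zero_left x
  have h3 := D.b_self (x + y)
  rw [D.bichar.add_left, D.bichar.add_right, D.bichar.add_right, D.b_self, D.b_self] at h3
  have h4 : qHat q (x + y) = omega q x y * (qHat q x * qHat q y) := by
    rw [qHat, qHat, qHat, omega, ← AddChar.map_add_eq_mul, ← AddChar.map_add_eq_mul,
      QuadraticMap.polar]
    congr 1
    ring
  rw [h4] at h3
  have h5 : D.b x y * D.b y x = omega q x y := by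
    apply mul_right_cancel (b := qHat q x * qHat q y)
    rw [← h3]
    ac_rfl
  rw [← h5]
  change D.b x y / D.b y x = _
  rw [div_eq_mul_inv, inv_eq_of_mul_eq_one_left h2]

theorem PsData.nondegenerate [Finite k] (hq : (QuadraticMap.polarBilin q).Nondegenerate)
    (D : PsData 2 (qHat q)) : D.bichar.toCocycle.Nondegenerate := by
  intro x h
  apply omega_nondegenerate hq
  intro y
  rw [← D.alt_eq, Cocycle.alt, h, div_self']

variable [Finite k] (hq : (QuadraticMap.polarBilin q).Nondegenerate)

/-- The crossed system of `APs_k(V) = V̂ #_θ Sp_k(V) ⊆ V̂ #_θ Sp(V, ω)`. -/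
def apsSystem (D : APsData (omega q)) : CrossedSystem (SpLin q) (AddChar V ℂˣ) :=
  (D.lifts.weilSystem (D.nondegenerate hq)).comap (spIncl q)

/-- The crossed system of `Ps_k(V, q) = V̂ #_θ O_k(V, q) ⊆ V̂ #_θ O(V, q̂)`. -/
def psSystem (D : PsData 2 (qHat q)) : CrossedSystem (OrthLin q) (AddChar V ℂˣ) :=
  (D.lifts.weilSystem (D.nondegenerate hq)).comap (orthIncl q)

/-- The crossed system of `V̂ #_θ Ω_k(V, q) ⊆ Ps_k(V, q)`. -/
def omegaSystem (D : PsData 2 (qHat q)) : CrossedSystem (OmegaLin q) (AddChar V ℂˣ) :=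
  (psSystem hq D).comap (OmegaLin q).subtype

end Extensions

end

end PseudoSymplectic

namespace PseudoSymplectic

open QuadraticMap

/-! ### Splittings as multiplicative families of monomial automorphisms -/

section Splitting

variable {V Y : Type*} [AddCommGroup V] [Group Y] {α : Cocycle V} {H : Subgroup (AutGrp V)}

/-! A splitting makes the group act on `ℂ_α[V]` by u_x ↦ ζ_g(x) u_{gx}, with ζ_{gh}(x) = ζ_g(hx)
ζ_h(x) (`exists_cochain_of_splitting`). One involution g then yields a contradiction.

Let g be the Siegel transformation of (u, w), where u is singular, w ⟂ u and q(w) = c has trace 1.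
Take v with B(u, v) = 1 and B(w, v) = 0. Then v + gv = w + cu and B(v, gv) = c. Since g² = 1, ζ_g(v)
ζ_g(gv) = 1, so compatibility with the product makes ζ_g(v + gv) equal to ω(v, gv) = -1.

On the other hand, ζ_g is multiplicative on vectors orthogonal to u and w, which g fixes. If y is
such a vector and is singular, and some Siegel transformation h commutes with g and sends a fixed
vector x to x + y, then comparing ζ_{gh}(x) with ζ_{hg}(x) gives ζ_g(y) = 1 (`cochain_eq_one`). As w
+ cu is a sum of four such y, ζ_g(v + gv) = 1, a contradiction (`not_exists_cochain`).

The configuration occupies four mutually orthogonal planes, hence dimension 8; they are split off by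
`exists_hyperbolic_pair`. Siegel transformations have Dickson invariant zero
(`siegel_mem_omegaLin`), so one argument serves all three groups. Existence of the data is a
separate matter of quadratic forms over 𝔽₂ (`exists_polar_eq_of_alternating`,
`exists_coboundary_of_symmetric`). -/

/-- A splitting of the extension given by a family of lifts is a multiplicative family
`u_x ↦ ζ_g(x) u_{g x}` of algebra automorphisms of `ℂ_α[V]`. -/
theorem LiftFamily.exists_cochain_of_splitting (L : LiftFamily α H) (hα : α.Nondegenerate)
    (f : Y →* H) (s : ((L.weilSystem hα).comap f).extension.Splitting) :
    ∃ ζ : Y → V → ℂˣ,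
      (∀ g x y, α ((f g).1 x) ((f g).1 y) * (ζ g x * ζ g y) = α x y * ζ g (x + y)) ∧
      ∀ g h x, ζ (g * h) x = ζ g ((f h).1 x) * ζ h x := by
  have hsnd : ∀ g, (s.toMonoidHom g).snd = g := s.rightInverse_rightHom
  let χ : Y → AddChar V ℂˣ := fun g => (s.toMonoidHom g).fst
  -- In Aut(A) the twisted product of (χ, g) and (ψ, h) becomes composition of χα_g with ψα_h: the
  -- conjugation by α_g and the factor θ(g, h) cancel.
  have hχ : ∀ g h, α.diag (χ (g * h)) * L.lift (f (g * h)) =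
      (α.diag (χ g) * L.lift (f g)) * (α.diag (χ h) * L.lift (f h)) := by
    intro g h
    have h1 : χ (g * h) = χ g * (L.weilSystem hα).act (f g) (χ h) *
        (L.weilSystem hα).θ (f g) (f h) := by
      have h2 := congrArg CrossedSystem.Product.fst (map_mul s.toMonoidHom g h)
      rw [CrossedSystem.mul_def, hsnd, hsnd] at h2
      exact h2
    have h3 := congrArg (fun ψ => (α.dualEquiv hα ψ).1) h1
    simp only [map_mul, LiftFamily.weilSystem, CrossedSystem.congr, MulEquiv.apply_symm_apply,
      Subgroup.coe_mul] at h3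
    have h4 : ∀ ψ, (α.dualEquiv hα ψ).1 = α.diag ψ := fun _ => rfl
    simp only [h4, LiftFamily.autSystem] at h3
    rw [h3, map_mul]
    group
  -- The diagonal automorphism acts after α_g, so χ_g is evaluated at g x.
  refine ⟨fun g x => χ g ((f g).1 x) * L.η (f g) x, fun g x y => ?_, fun g h x => ?_⟩
  · have h1 := L.coboundary (f g) x y
    beta_reduce
    rw [map_add, AddChar.map_add_eq_mul]
    rw [mul_mul_mul_comm (χ g _), mul_left_comm, h1, mul_left_comm]
  · have h1 := DFunLike.congr_fun (hχ g h) (α.u x)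
    simp only [AlgEquiv.mul_apply, L.lift_u, map_smul, α.diag_u, smul_smul] at h1
    have h2 : (f (g * h)).1 x = (f g).1 ((f h).1 x) := by rw [map_mul]; rfl
    beta_reduce
    rw [h2] at h1 ⊢
    have h3 := α.smul_u_injective _ h1
    apply Units.ext
    push_cast
    linear_combination h3

end Splitting

/-! ### Siegel transformations in characteristic two -/

section Siegel

variable {k V : Type*} [Field k] [AddCommGroup V] [Module k V] (q : QuadraticForm k V)

theorem polar_self_eq_zero [CharP k 2] (x : V) : polar q x x = 0 := by
  rw [polar_self, two_smul, CharTwo.add_self_eq_zero]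

/-- The map `x ↦ x + B(u, x) w + B(w, x) u + q(w) B(u, x) u`. -/
def siegelLin (u w : V) : V →ₗ[k] V :=
  LinearMap.id + (polarBilin q u).smulRight w + (polarBilin q w).smulRight u +
    q w • (polarBilin q u).smulRight u

theorem siegelLin_apply (u w x : V) : siegelLin q u w x =
    x + polar q u x • w + polar q w x • u + (q w * polar q u x) • u := by
  simp [siegelLin, smul_smul]

variable {q}

theorem polar_map {g : V ≃ₗ[k] V} (hg : g ∈ OrthLin q) (x y : V) :
    polar q (g x) (g y) = polar q x y := by
  rw [polar, polar, ← map_add, hg, hg, hg]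

variable [CharP k 2] {u w : V}

/-- The map changes neither B(u, x) nor B(w, x), because B is alternating and u ⟂ w. A second
application therefore adds the same correction again, and it cancels in characteristic two. -/
theorem siegelLin_involutive (huw : polar q u w = 0) :
    Function.Involutive (siegelLin q u w) := by
  intro x
  have h2 : (2 : k) = 0 := CharTwo.two_eq_zero
  have hwu : polar q w u = 0 := by rw [polar_comm, huw]
  rw [siegelLin_apply q u w (siegelLin q u w x), siegelLin_apply]
  simp only [polar_add_right, polar_smul_right, polar_self_eq_zero, huw, hwu, smul_eq_mul,
    mul_zero, add_zero]
  linear_combination (norm := module) (polar q u x * h2) • w + (polar q w x * h2) • u +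
    (q w * polar q u x * h2) • u

/-- The Siegel transformation (Eichler transformation) attached to a singular vector `u` and a
vector `w` orthogonal to it. -/
def siegel (_hu : q u = 0) (huw : polar q u w = 0) : V ≃ₗ[k] V :=
  LinearEquiv.ofInvolutive (siegelLin q u w) (siegelLin_involutive huw)

theorem siegel_apply (hu : q u = 0) (huw : polar q u w = 0) (x : V) : siegel hu huw x =
    x + polar q u x • w + polar q w x • u + (q w * polar q u x) • u := siegelLin_apply q u w x

theorem siegel_mul_self (hu : q u = 0) (huw : polar q u w = 0) :
    siegel hu huw * siegel hu huw = 1 :=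
  LinearEquiv.ext (siegelLin_involutive huw)

theorem siegel_apply_of_orthogonal (hu : q u = 0) (huw : polar q u w = 0) {x : V}
    (h1 : polar q u x = 0) (h2 : polar q w x = 0) : siegel hu huw x = x := by
  rw [siegel_apply, h1, h2]
  simp

theorem siegel_mem_orthLin (hu : q u = 0) (huw : polar q u w = 0) : siegel hu huw ∈ OrthLin q := by
  intro x
  have h2 : (2 : k) = 0 := CharTwo.two_eq_zero
  have hwu : polar q w u = 0 := by rw [polar_comm, huw]
  rw [siegel_apply]
  simp only [QuadraticMap.map_add q, QuadraticMap.map_smul, polar_add_left, polar_smul_left,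
    polar_smul_right, hu, hwu, polar_self_eq_zero, smul_eq_mul, polar_comm q x]
  linear_combination (polar q u x * polar q w x + polar q u x * polar q u x * q w) * h2

/-- Conjugation by an isometry g turns the Siegel transformation of (u, w) into that of (gu, gw). -/
theorem siegel_mul_comm {g : V ≃ₗ[k] V} (hg : g ∈ OrthLin q) (hu : q u = 0)
    (huw : polar q u w = 0) (hgu : g u = u) (hgw : g w = w) :
    g * siegel hu huw = siegel hu huw * g := by
  ext x
  have h1 := polar_map hg u x
  have h2 := polar_map hg w x
  rw [hgu] at h1
  rw [hgw] at h2
  rw [LinearEquiv.mul_apply, LinearEquiv.mul_apply, siegel_apply, siegel_apply, h1, h2]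
  simp [hgu, hgw]

/-- In the Clifford algebra, the Siegel transformation is conjugation by `1 + u w`. -/
theorem siegel_conj (hu : q u = 0) (huw : polar q u w = 0) (x : V) :
    CliffordAlgebra.ι q (siegel hu huw x) * (1 + CliffordAlgebra.ι q u * CliffordAlgebra.ι q w) =
      (1 + CliffordAlgebra.ι q u * CliffordAlgebra.ι q w) * CliffordAlgebra.ι q x := by
  have hwu : CliffordAlgebra.ι q w * CliffordAlgebra.ι q u =
      -(CliffordAlgebra.ι q u * CliffordAlgebra.ι q w) := by
    rw [eq_neg_iff_add_eq_zero, add_comm, CliffordAlgebra.ι_mul_ι_add_swap, huw, map_zero]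
  have huu : CliffordAlgebra.ι q u * CliffordAlgebra.ι q u = 0 := by
    rw [CliffordAlgebra.ι_sq_scalar, hu, map_zero]
  have hww : CliffordAlgebra.ι q w * CliffordAlgebra.ι q w = q w • 1 := by
    rw [CliffordAlgebra.ι_sq_scalar, Algebra.algebraMap_eq_smul_one]
  have hwx : CliffordAlgebra.ι q w * CliffordAlgebra.ι q x =
      polar q w x • 1 - CliffordAlgebra.ι q x * CliffordAlgebra.ι q w := by
    rw [eq_sub_iff_add_eq, CliffordAlgebra.ι_mul_ι_add_swap, Algebra.algebraMap_eq_smul_one]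
  have hux : CliffordAlgebra.ι q u * CliffordAlgebra.ι q x =
      polar q u x • 1 - CliffordAlgebra.ι q x * CliffordAlgebra.ι q u := by
    rw [eq_sub_iff_add_eq, CliffordAlgebra.ι_mul_ι_add_swap, Algebra.algebraMap_eq_smul_one]
  have hwuw : CliffordAlgebra.ι q w * (CliffordAlgebra.ι q u * CliffordAlgebra.ι q w) =
      -(q w • CliffordAlgebra.ι q u) := by
    rw [← mul_assoc, hwu, neg_mul, mul_assoc, hww, mul_smul_comm, mul_one]
  have huuw : CliffordAlgebra.ι q u * (CliffordAlgebra.ι q u * CliffordAlgebra.ι q w) = 0 := by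
    rw [← mul_assoc, huu, zero_mul]
  have huwx : CliffordAlgebra.ι q u * CliffordAlgebra.ι q w * CliffordAlgebra.ι q x =
      polar q w x • CliffordAlgebra.ι q u - polar q u x • CliffordAlgebra.ι q w +
        CliffordAlgebra.ι q x * (CliffordAlgebra.ι q u * CliffordAlgebra.ι q w) := by
    rw [mul_assoc, hwx, mul_sub, ← mul_assoc _ (CliffordAlgebra.ι q x), hux, sub_mul,
      mul_smul_comm, mul_one, smul_mul_assoc, one_mul, mul_assoc]
    abel
  have h2 : (2 : k) = 0 := CharTwo.two_eq_zero
  rw [siegel_apply, add_mul 1, huwx, one_mul, mul_add, mul_one]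
  simp only [map_add, map_smul, add_mul, smul_mul_assoc, hwuw, huuw]
  linear_combination (norm := module) (polar q u x * h2) • CliffordAlgebra.ι q w

/-- By `siegel_conj`, the induced automorphism of the Clifford algebra is conjugation by the even
element e = 1 + uw. Central elements of the even subalgebra commute with e and so are fixed. -/
theorem siegel_mem_omegaLin (hu : q u = 0) (huw : polar q u w = 0) :
    (⟨siegel hu huw, siegel_mem_orthLin hu huw⟩ : OrthLin q) ∈ OmegaLin q := by
  change dickson _ = 0
  rw [dickson_eq_zero_iff]
  intro z hz hc
  have hwu : CliffordAlgebra.ι q w * CliffordAlgebra.ι q u =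
      -(CliffordAlgebra.ι q u * CliffordAlgebra.ι q w) := by
    rw [eq_neg_iff_add_eq_zero, add_comm, CliffordAlgebra.ι_mul_ι_add_swap, huw, map_zero]
  obtain ⟨e, he⟩ : ∃ e, e = 1 + CliffordAlgebra.ι q u * CliffordAlgebra.ι q w := ⟨_, rfl⟩
  have he_even : e ∈ CliffordAlgebra.even q := by
    rw [he]
    exact add_mem (one_mem _) (CliffordAlgebra.ι_mul_ι_mem_evenOdd_zero q u w)
  -- (uw)² = -u²w² = 0, and the cross term 2uw vanishes.
  have hee : e * e = 1 := by
    have h1 : CliffordAlgebra.ι q u * CliffordAlgebra.ι q w *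
        (CliffordAlgebra.ι q u * CliffordAlgebra.ι q w) = 0 := by
      rw [mul_assoc, ← mul_assoc (CliffordAlgebra.ι q w), hwu, neg_mul, mul_neg, mul_assoc,
        ← mul_assoc, CliffordAlgebra.ι_sq_scalar, hu, map_zero, zero_mul, neg_zero]
    have h2 : (2 : k) = 0 := CharTwo.two_eq_zero
    rw [he, add_mul, mul_add, mul_add, h1, one_mul, one_mul, mul_one]
    linear_combination (norm := module) h2 • (CliffordAlgebra.ι q u * CliffordAlgebra.ι q w)
  have hconj : ∀ y, cliffordMap ⟨siegel hu huw, siegel_mem_orthLin hu huw⟩ y * e = e * y := by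
    intro y
    induction y using CliffordAlgebra.induction with
    | algebraMap r => rw [AlgHom.commutes, Algebra.commutes]
    | ι x =>
      rw [he, cliffordMap, CliffordAlgebra.map_apply_ι]
      exact siegel_conj hu huw x
    | mul a b ha hb => rw [map_mul, mul_assoc, hb, ← mul_assoc, ha, mul_assoc]
    | add a b ha hb => rw [map_add, add_mul, ha, hb, mul_add]
  have h3 := hconj z
  rw [hc e he_even] at h3
  rw [← mul_one (cliffordMap _ z), ← hee, ← mul_assoc, h3, mul_assoc, hee, mul_one]

end Siegel

/-! ### The obstruction -/

section Obstruction

variable {k V Y : Type*} [Field k] [CharP k 2] [AddCommGroup V] [Module k V] [Group Y]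
  {q : QuadraticForm k V} {α : Cocycle V} {ρ : Y →* (V ≃ₗ[k] V)} {ζ : Y → V → ℂˣ}

/-- On the vectors fixed by a Siegel transformation `g` of `(u, w)`, the cochain `ζ_g` is trivial at
every singular vector `y` orthogonal to `u` and `w` for which some Siegel transformation of `(y, z)`
commutes with `g` and maps a fixed vector `x` of `g` to `x + y`. -/
theorem cochain_eq_one (hinj : Function.Injective ρ)
    (hζ : ∀ g x y, α (ρ g x) (ρ g y) * (ζ g x * ζ g y) = α x y * ζ g (x + y))
    (hmul : ∀ g h x, ζ (g * h) x = ζ g (ρ h x) * ζ h x)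
    (hρ : ∀ (u w : V) (hu : q u = 0) (huw : polar q u w = 0), ∃ g, ρ g = siegel hu huw)
    {u w : V} (hu : q u = 0) (huw : polar q u w = 0) {g : Y} (hg : ρ g = siegel hu huw)
    {x y z : V} (hy : q y = 0) (huy : polar q u y = 0) (hwy : polar q w y = 0)
    (hux : polar q u x = 0) (hwx : polar q w x = 0) (hyx : polar q y x = 0)
    (huz : polar q u z = 0) (hwz : polar q w z = 0) (hyz : polar q y z = 0)
    (hzx : polar q z x = 1) : ζ g y = 1 := by
  obtain ⟨h, hh⟩ := hρ y z hy hyz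
  have hhx : ρ h x = x + y := by
    rw [hh, siegel_apply, hyx, hzx]
    simp
  have hgx : ρ g x = x := by rw [hg, siegel_apply_of_orthogonal hu huw hux hwx]
  have hgy : ρ g y = y := by rw [hg, siegel_apply_of_orthogonal hu huw huy hwy]
  -- h fixes u and w because both are orthogonal to y and z.
  have hcomm : h * g = g * h := by
    apply hinj
    rw [map_mul, map_mul, hg, hh]
    refine siegel_mul_comm (siegel_mem_orthLin hy hyz) hu huw ?_ ?_ <;>
      apply siegel_apply_of_orthogonal <;> rw [polar_comm] <;> assumption
  have h1 := hmul h g x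
  rw [hcomm, hmul g h x, hhx, hgx, mul_comm] at h1
  have h2 := hζ g x y
  rw [hgx, hgy, mul_left_cancel h1] at h2
  exact mul_eq_left.mp (mul_left_cancel h2)

/-- The contradiction on an explicit configuration. The plane (u, v) carries the involution, (e, f)
supplies w, (e', f') serves to break w into singular vectors, and (x, z) is kept free for
`cochain_eq_one`; x and z need not be singular. -/
theorem not_exists_cochain (hinj : Function.Injective ρ)
    (hα : ∀ x y, α.alt x y = omega q x y)
    (hζ : ∀ g x y, α (ρ g x) (ρ g y) * (ζ g x * ζ g y) = α x y * ζ g (x + y))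
    (hmul : ∀ g h x, ζ (g * h) x = ζ g (ρ h x) * ζ h x)
    (hρ : ∀ (u w : V) (hu : q u = 0) (huw : polar q u w = 0), ∃ g, ρ g = siegel hu huw)
    {u v e f e' f' x z : V} (hu : q u = 0) (huv : polar q u v = 1)
    (he : q e = 0) (hf : q f = 0) (hef : polar q e f = 1)
    (he' : q e' = 0) (hf' : q f' = 0) (hef' : polar q e' f' = 1) (hzx : polar q z x = 1)
    (hu_perp : ∀ y ∈ [e, f, e', f', x, z], polar q u y = 0)
    (hv_perp : ∀ y ∈ [e, f, e', f'], polar q v y = 0)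
    (he_perp : ∀ y ∈ [e', f', x, z], polar q e y = 0)
    (hf_perp : ∀ y ∈ [e', f', x, z], polar q f y = 0)
    (he'_perp : ∀ y ∈ [x, z], polar q e' y = 0)
    (hf'_perp : ∀ y ∈ [x, z], polar q f' y = 0)
    (c : k) (hc : traceChar k c ≠ 1) : False := by
  simp only [List.mem_cons, List.not_mem_nil, or_false, forall_eq_or_imp, forall_eq] at *
  obtain ⟨ue, uf, ue', uf', ux, uz⟩ := hu_perp
  obtain ⟨ve, vf, ve', vf'⟩ := hv_perp
  obtain ⟨ee', ef', ex, ez⟩ := he_perp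
  obtain ⟨fe', ff', fx, fz⟩ := hf_perp
  obtain ⟨e'x, e'z⟩ := he'_perp
  obtain ⟨f'x, f'z⟩ := hf'_perp
  have h2 : (2 : k) = 0 := CharTwo.two_eq_zero
  have hu0 := polar_self_eq_zero q u
  have he0 := polar_self_eq_zero q e
  have hf0 := polar_self_eq_zero q f
  have hfe : polar q f e = 1 := by rw [polar_comm, hef]
  -- Chosen so that q(w) = c B(e, f) = c while w stays orthogonal to u, v and the other two planes.
  obtain ⟨w, hw⟩ : ∃ w, w = e + c • f := ⟨_, rfl⟩
  have huw : polar q u w = 0 := by rw [hw]; simp [polar_add_right, polar_smul_right, *]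
  have hvw : polar q v w = 0 := by rw [hw]; simp [polar_add_right, polar_smul_right, *]
  have hwu : polar q w u = 0 := by rw [polar_comm, huw]
  have hww := polar_self_eq_zero q w
  have hwe' : polar q w e' = 0 := by rw [hw]; simp [polar_add_left, polar_smul_left, *]
  have hwf' : polar q w f' = 0 := by rw [hw]; simp [polar_add_left, polar_smul_left, *]
  have hwx : polar q w x = 0 := by rw [hw]; simp [polar_add_left, polar_smul_left, *]
  have hwz : polar q w z = 0 := by rw [hw]; simp [polar_add_left, polar_smul_left, *]
  have hqw : q w = c := by
    rw [hw, QuadraticMap.map_add q, QuadraticMap.map_smul, polar_smul_right, he, hf, hef]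
    simp
  clear hw
  obtain ⟨g, hg⟩ := hρ u w hu huw
  have key : ∀ y, q y = 0 → polar q u y = 0 → polar q w y = 0 → polar q y x = 0 →
      polar q y z = 0 → ζ g y = 1 := fun y hy huy hwy hyx hyz =>
    cochain_eq_one hinj hζ hmul hρ hu huw hg hy huy hwy ux hwx hyx uz hwz hyz hzx
  -- Since g fixes y and y', the two values of α cancel.
  have hadd : ∀ y y', polar q u y = 0 → polar q w y = 0 → polar q u y' = 0 → polar q w y' = 0 →
      ζ g y = 1 → ζ g y' = 1 → ζ g (y + y') = 1 := by
    intro y y' huy hwy huy' hwy' h h'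
    have h1 := hζ g y y'
    rw [hg, siegel_apply_of_orthogonal hu huw huy hwy,
      siegel_apply_of_orthogonal hu huw huy' hwy', h, h', mul_one] at h1
    exact (mul_left_cancel h1).symm
  have h1 : ζ g (c • u) = 1 := by
    apply key <;> simp [QuadraticMap.map_smul, polar_smul_left, polar_smul_right, *]
  have h3 : ζ g e' = 1 := by
    apply key <;> assumption
  have h4 : ζ g (c • f') = 1 := by
    apply key <;> simp [QuadraticMap.map_smul, polar_smul_left, polar_smul_right, *]
  -- Singular because q(w) = c and q(e' + cf') = c add up to zero.
  have h5 : ζ g (w + e' + c • f') = 1 := by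
    apply key
    · simp only [QuadraticMap.map_add q, QuadraticMap.map_smul, polar_add_left, polar_smul_right,
        hqw, he', hf', hwe', hwf', hef', smul_eq_mul]
      linear_combination c * h2
    all_goals simp [polar_add_left, polar_add_right, polar_smul_left, polar_smul_right,
      *]
  -- v + gv = w + cu is the sum of the four singular vectors just treated: e' and cf' each occur
  -- twice.
  have h6 : ζ g (v + ρ g v) = 1 := by
    have h7 : v + ρ g v = (c • u + e') + (c • f' + (w + e' + c • f')) := by
      rw [hg, siegel_apply, huv, hqw, polar_comm q w v, hvw]
      linear_combination (norm := module) h2 • v - h2 • e' - (c * h2) • f'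
    rw [h7]
    apply hadd
    any_goals apply hadd
    all_goals first | assumption | skip
    all_goals simp [polar_add_right, polar_smul_right, *]
  have hone : ∀ y, ζ 1 y = 1 := by
    intro y
    have h := hmul 1 1 y
    rw [one_mul, map_one] at h
    exact mul_eq_left.mp h.symm
  have hgg : g * g = 1 := by
    apply hinj
    rw [map_mul, hg, siegel_mul_self, map_one]
  have hgv : ρ g (ρ g v) = v := by
    rw [← LinearEquiv.mul_apply, ← map_mul, hgg, map_one]
    rfl
  -- With ζ_g(gv) ζ_g(v) = ζ_{g²}(v) = 1 and the value at v + gv already 1, this says α(gv, v) =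
  -- α(v, gv), whereas their quotient is the trace character at B(v, gv) = c.
  have h8 := hζ g v (ρ g v)
  rw [h6, hgv, mul_comm (ζ g v), ← hmul, hgg, hone, mul_one, mul_one] at h8
  have h9 := hα v (ρ g v)
  rw [Cocycle.alt, h8, div_self', omega] at h9
  apply hc
  rw [h9]
  congr 1
  rw [hg, siegel_apply, huv, hqw, polar_comm q w v, hvw]
  simp only [polar_add_right, polar_smul_right, hvw, polar_self_eq_zero, polar_comm q v u, huv]
  simp

end Obstruction

/-! ### Hyperbolic pairs -/

section Hyperbolic

variable {k V : Type*} [Field k] [Finite k] [CharP k 2] [AddCommGroup V] [Module k V]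
  [FiniteDimensional k V] (q : QuadraticForm k V)

/-- A subspace of dimension at least three on which the polar form is nondegenerate contains a
hyperbolic pair, the orthogonal complement of which has codimension at most two and is again
nondegenerate. -/
theorem exists_hyperbolic_pair (P : Submodule k V)
    (hP : ∀ x ∈ P, (∀ y ∈ P, polar q x y = 0) → x = 0) (hdim : 3 ≤ Module.finrank k P) :
    ∃ e ∈ P, ∃ f ∈ P, q e = 0 ∧ q f = 0 ∧ polar q e f = 1 ∧ ∃ P' ≤ P,
      (∀ y ∈ P', polar q e y = 0) ∧ (∀ y ∈ P', polar q f y = 0) ∧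
      (∀ x ∈ P', (∀ y ∈ P', polar q x y = 0) → x = 0) ∧
      Module.finrank k P ≤ Module.finrank k P' + 2 := by
  have hself := polar_self_eq_zero q
  have hperp : ∀ {M : Type _} [AddCommGroup M] [Module k M] (φ : P →ₗ[k] M)
      [FiniteDimensional k M], Module.finrank k P ≤
        Module.finrank k (φ.ker.map P.subtype) + Module.finrank k M := by
    intro M _ _ φ _
    rw [LinearEquiv.finrank_eq (Submodule.equivSubtypeMap P φ.ker).symm,
      ← LinearMap.finrank_range_add_finrank_ker φ, add_comm]
    exact Nat.add_le_add_left (Submodule.finrank_le _) _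
  obtain ⟨e, heP, he0, he⟩ : ∃ e ∈ P, e ≠ 0 ∧ q e = 0 := by
    obtain ⟨⟨x, hxP⟩, hx0⟩ : ∃ x : P, x ≠ 0 := by
      have : Nontrivial P := Module.nontrivial_of_finrank_pos (R := k) (by omega)
      exact exists_ne 0
    by_cases hqx : q x = 0
    · exact ⟨x, hxP, fun h => hx0 (Subtype.ext h), hqx⟩
    let φ : P →ₗ[k] k := (polarBilin q x).comp P.subtype
    have h1 := hperp φ
    rw [Module.finrank_self] at h1
    -- In characteristic two x lies in its own orthogonal complement. Dimension at least three makes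
    -- that complement larger than the line of x.
    obtain ⟨y, hy, hyx⟩ : ∃ y ∈ φ.ker.map P.subtype, y ∉ k ∙ x := by
      by_contra! h
      have h2 := Submodule.finrank_mono (show φ.ker.map P.subtype ≤ k ∙ x from h)
      have h3 := finrank_span_le_card (R := k) ({x} : Set V)
      rw [Set.toFinset_singleton, Finset.card_singleton] at h3
      omega
    obtain ⟨⟨y, hyP⟩, hyk, rfl⟩ := hy
    have hxy : polar q x y = 0 := hyk
    -- For y ⟂ x one has q(y + tx) = q(y) + t²q(x), and every element of k is a square.
    obtain ⟨t, ht⟩ := FiniteField.isSquare_of_char_two (ringChar.eq k 2) (q y / q x)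
    refine ⟨y + t • x, P.add_mem hyP (P.smul_mem t hxP), fun h => hyx ?_, ?_⟩
    · rw [Submodule.mem_span_singleton]
      refine ⟨-t, ?_⟩
      rw [neg_smul, eq_comm]
      exact eq_neg_of_add_eq_zero_left h
    · rw [QuadraticMap.map_add q, QuadraticMap.map_smul, polar_smul_right, polar_comm, hxy, ← ht,
        smul_eq_mul, div_mul_cancel₀ _ hqx, smul_zero, add_zero, CharTwo.add_self_eq_zero]
  obtain ⟨f₀, hf₀P, hf₀⟩ : ∃ f ∈ P, polar q e f ≠ 0 := by
    by_contra! h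
    exact he0 (hP e heP h)
  obtain ⟨f, hfP, hf, hef⟩ : ∃ f ∈ P, q f = 0 ∧ polar q e f = 1 := by
    obtain ⟨f₁, hf₁P, hef₁⟩ : ∃ f ∈ P, polar q e f = 1 :=
      ⟨(polar q e f₀)⁻¹ • f₀, P.smul_mem _ hf₀P, by
        rw [polar_smul_right, smul_eq_mul, inv_mul_cancel₀ hf₀]⟩
    refine ⟨f₁ + q f₁ • e, P.add_mem hf₁P (P.smul_mem _ heP), ?_, ?_⟩
    · rw [QuadraticMap.map_add q, QuadraticMap.map_smul, polar_smul_right, polar_comm, hef₁, he]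
      simp [CharTwo.add_self_eq_zero]
    · rw [polar_add_right, polar_smul_right, hself, hef₁, smul_zero, add_zero]
  let φ : P →ₗ[k] k × k :=
    ((polarBilin q e).comp P.subtype).prod ((polarBilin q f).comp P.subtype)
  have hmem : ∀ y, y ∈ φ.ker.map P.subtype ↔ y ∈ P ∧ polar q e y = 0 ∧ polar q f y = 0 := by
    intro y
    constructor
    · rintro ⟨⟨y, hyP⟩, hy, rfl⟩
      exact ⟨hyP, Prod.ext_iff.mp hy⟩
    · rintro ⟨hyP, hy⟩
      exact ⟨⟨y, hyP⟩, Prod.ext_iff.mpr hy, rfl⟩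
  refine ⟨e, heP, f, hfP, he, hf, hef, φ.ker.map P.subtype, fun y hy => ((hmem y).mp hy).1,
    fun y hy => ((hmem y).mp hy).2.1, fun y hy => ((hmem y).mp hy).2.2, fun x hx h => ?_, ?_⟩
  · obtain ⟨hxP, hex, hfx⟩ := (hmem x).mp hx
    apply hP x hxP
    intro y hyP
    have hfe : polar q f e = 1 := by rw [polar_comm, hef]
    have hxe : polar q x e = 0 := by rw [polar_comm, hex]
    have hxf : polar q x f = 0 := by rw [polar_comm, hfx]
    -- The projection of y to the orthogonal complement of the hyperbolic plane; x pairs with it as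
    -- with y.
    have h1 := h (y - polar q f y • e - polar q e y • f) ((hmem _).mpr
      ⟨P.sub_mem (P.sub_mem hyP (P.smul_mem _ heP)) (P.smul_mem _ hfP), by
        simp [polar_sub_right, polar_smul_right, hself, hef], by
        simp [polar_sub_right, polar_smul_right, hself, hfe]⟩)
    simpa [polar_sub_right, polar_smul_right, hxe, hxf] using h1
  · have h1 := hperp φ
    rwa [Module.finrank_prod, Module.finrank_self] at h1

end Hyperbolic

/-! ### Existence of the cochains -/

section Existence

/-- The nontrivial character `t ↦ (-1)^t` of `𝔽₂`. -/
noncomputable def signChar : AddChar (ZMod 2) ℂˣ := Circle.toUnits.compAddChar ZMod.toCircle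

theorem signChar_one : signChar 1 = -1 := by
  apply Units.ext
  change ((ZMod.toCircle (1 : ZMod 2) : Circle) : ℂ) = -1
  rw [ZMod.toCircle_apply]
  have h : (2 * (Real.pi : ℂ) * Complex.I * ((1 : ZMod 2).val : ℂ) / ((2 : ℕ) : ℂ)) =
      Real.pi * Complex.I := by
    rw [ZMod.val_one]
    push_cast
    ring
  rw [h, Complex.exp_pi_mul_I]

theorem signChar_injective : Function.Injective signChar := fun _ _ h =>
  ZMod.injective_toCircle (Circle.ext (congrArg Units.val h))

theorem signChar_sq (t : ZMod 2) : signChar t ^ 2 = 1 := by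
  rw [_root_.sq, ← AddChar.map_add_eq_mul, CharTwo.add_self_eq_zero, AddChar.map_zero_eq_one]

theorem signChar_inv (t : ZMod 2) : (signChar t)⁻¹ = signChar t :=
  inv_eq_of_mul_eq_one_left (by rw [← _root_.sq, signChar_sq])

variable {V : Type*} [AddCommGroup V]

/-- An alternating bilinear form over `𝔽₂` is the polar form of a quadratic form. -/
theorem exists_polar_eq_of_alternating [Module (ZMod 2) V] (C : V →ₗ[ZMod 2] V →ₗ[ZMod 2] ZMod 2)
    (hC : ∀ x, C x x = 0) : ∃ Q : V → ZMod 2, ∀ x y, Q (x + y) = Q x + Q y + C x y := by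
  classical
  let v := Module.Free.chooseBasis (ZMod 2) V
  let _ : LinearOrder (Module.Free.ChooseBasisIndex (ZMod 2) V) :=
    IsWellOrder.linearOrder WellOrderingRel
  have hsymm : ∀ x y, C x y = C y x := by
    intro x y
    have h := hC (x + y)
    simp only [map_add, LinearMap.add_apply, hC, zero_add, add_zero] at h
    exact (CharTwo.add_eq_zero.mp h).symm
  -- The strictly upper triangular half of C in an arbitrarily ordered basis. Then C = D + Dᵗ
  -- because C is symmetric with zero diagonal, and x ↦ D(x, x) has polar form C.
  let D : V →ₗ[ZMod 2] V →ₗ[ZMod 2] ZMod 2 :=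
    v.constr (ZMod 2) fun i => v.constr (ZMod 2) fun j => if i < j then C (v i) (v j) else 0
  have hD : D + D.flip = C := by
    refine v.ext fun i => v.ext fun j => ?_
    simp only [LinearMap.add_apply, LinearMap.flip_apply, D, Module.Basis.constr_basis]
    rcases lt_trichotomy i j with h | h | h
    · simp [h, h.not_gt]
    · simp [h, hC]
    · simp [h, h.not_gt, hsymm (v i)]
  refine ⟨fun x => D x x, fun x y => ?_⟩
  rw [← hD]
  simp only [map_add, LinearMap.add_apply, LinearMap.flip_apply]
  ring

/-- The coboundary of `t ↦ i^t`, `t ∈ {0, 1}`, is `(s, t) ↦ (-1)^{st}`. -/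
theorem exists_sqrt_signChar : ∃ σ : ZMod 2 → ℂˣ,
    ∀ s t, σ s * σ t = signChar (s * t) * σ (s + t) := by
  refine ⟨fun t => if t = 0 then 1 else Units.mk0 Complex.I Complex.I_ne_zero, fun s t => ?_⟩
  have h : ∀ t : ZMod 2, t = 0 ∨ t = 1 := by decide
  rcases h s with rfl | rfl <;> rcases h t with rfl | rfl
  · simp
  · simp
  · simp
  · rw [mul_one, signChar_one, CharTwo.add_self_eq_zero]
    apply Units.ext
    simp

/-- The diagonal l(x) = C(x, x) of a symmetric form is additive. The form C - l ⊗ l is alternating,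
since t² = t in 𝔽₂, hence is the polar form of some Q; the remaining l ⊗ l is the coboundary of
i^{l(x)}. Thus η = (-1)^Q i^l. -/
theorem exists_coboundary_of_symmetric [Module (ZMod 2) V]
    (C : V →ₗ[ZMod 2] V →ₗ[ZMod 2] ZMod 2) (hC : ∀ x y, C x y = C y x) :
    ∃ η : V → ℂˣ, ∀ x y, η x * η y = signChar (C x y) * η (x + y) := by
  have hadd : ∀ x y, C (x + y) (x + y) = C x x + C y y := by
    intro x y
    simp only [map_add, LinearMap.add_apply, hC y x]
    linear_combination CharTwo.add_self_eq_zero (C x y)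
  let l : V →ₗ[ZMod 2] ZMod 2 := AddMonoidHom.toZModLinearMap 2
    { toFun := fun x => C x x
      map_zero' := by simp
      map_add' := hadd }
  have hl : ∀ x, l x = C x x := fun _ => rfl
  obtain ⟨Q, hQ⟩ := exists_polar_eq_of_alternating (C - l.smulRight l) (by
    have h : ∀ t : ZMod 2, t - t * t = 0 := by decide
    intro x
    simpa [hl] using h (C x x))
  obtain ⟨σ, hσ⟩ := exists_sqrt_signChar
  refine ⟨fun x => signChar (Q x) * σ (l x), fun x y => ?_⟩
  have h1 : signChar (Q x) * signChar (Q y) =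
      signChar (C x y - l x * l y) * signChar (Q (x + y)) := by
    rw [← AddChar.map_add_eq_mul, ← AddChar.map_add_eq_mul, hQ]
    congr 1
    simp only [LinearMap.sub_apply, LinearMap.smulRight_apply, LinearMap.smul_apply, smul_eq_mul]
    linear_combination -CharTwo.add_self_eq_zero (C x y - l x * l y)
  have h2 : signChar (C x y) = signChar (C x y - l x * l y) * signChar (l x * l y) := by
    rw [← AddChar.map_add_eq_mul, sub_add_cancel]
  beta_reduce
  rw [mul_mul_mul_comm, h1, hσ, h2, map_add, mul_mul_mul_comm]

end Existence

/-! ### Existence of the cocycles and cochains for `q` -/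

section ExistenceData

variable {k V : Type*} [Field k] [CharP k 2] [AddCommGroup V] [Module k V]

/-- The trace form `Tr(b(x, y))` of a bilinear form over `k`, as a bilinear form over `𝔽₂`. -/
theorem exists_bilinear_traceChar [Module (ZMod 2) V] (b : LinearMap.BilinForm k V) :
    ∃ C : V →ₗ[ZMod 2] V →ₗ[ZMod 2] ZMod 2, ∀ x y, traceChar k (b x y) = signChar (C x y) := by
  let _ := ZMod.algebra k 2
  let T : k →+ ZMod 2 := (Algebra.trace (ZMod 2) k).toAddMonoidHom
  refine ⟨AddMonoidHom.toZModLinearMap 2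
    { toFun := fun x => AddMonoidHom.toZModLinearMap 2 (T.comp (b x).toAddMonoidHom)
      map_zero' := ?_
      map_add' := ?_ }, fun x y => rfl⟩
  · ext y
    change T (b 0 y) = 0
    simp
  · intro x x'
    ext y
    change T (b (x + x') y) = T (b x y) + T (b x' y)
    simp

/-- Write q(x) = b(x, x) with b bilinear, usually not symmetric. For g preserving q̂, the forms Tr
b(x, y) and Tr b(gx, gy) agree on the diagonal, so their sum is alternating and hence the polar form
of some Q_g. Thus η_g = (-1)^{Q_g} takes only the values ±1. -/
theorem nonempty_psData (q : QuadraticForm k V) : Nonempty (PsData 2 (qHat q)) := by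
  classical
  have h2V : ∀ x : V, x + x = 0 := fun x => by
    rw [← two_smul k x, CharTwo.two_eq_zero, zero_smul]
  let _ : Module (ZMod 2) V := AddCommGroup.zmodModule fun x => by rw [two_nsmul, h2V]
  obtain ⟨b, hb⟩ := LinearMap.BilinMap.toQuadraticMap_surjective q
  obtain ⟨C, hC⟩ := exists_bilinear_traceChar b
  have hbi : IsBicharacter fun x y => traceChar k (b x y) :=
    ⟨fun x y z => by simp [AddChar.map_add_eq_mul], fun x y z => by simp [AddChar.map_add_eq_mul]⟩
  have hself : ∀ x, traceChar k (b x x) = qHat q x := fun x => by rw [qHat, ← hb]; rfl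
  have key : ∀ g : Orth (qHat q), ∃ Q : V → ZMod 2, (g = 1 → Q = 0) ∧
      ∀ x y, Q (x + y) = Q x + Q y + (C x y + C (g.1 x) (g.1 y)) := by
    intro g
    -- A quadratic form with zero polar form need not vanish, so Q = 0 is imposed at g = 1 to get
    -- η_1 = 1.
    by_cases hg : g = 1
    · refine ⟨0, fun _ => rfl, fun x y => ?_⟩
      subst hg
      exact (by simpa using (CharTwo.add_self_eq_zero (C x y)).symm)
    · let G : V →ₗ[ZMod 2] V := AddMonoidHom.toZModLinearMap 2 g.1.toLinearMap.toAddMonoidHom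
      obtain ⟨Q, hQ⟩ := exists_polar_eq_of_alternating (C + C.compl₁₂ G G) (by
        intro x
        have h1 : C (g.1 x) (g.1 x) = C x x := signChar_injective (by
          rw [← hC, ← hC, hself, hself]
          exact g.2 x)
        change C x x + C (g.1 x) (g.1 x) = 0
        rw [h1, CharTwo.add_self_eq_zero])
      exact ⟨Q, fun h => absurd h hg, hQ⟩
  choose Q hQ1 hQ using key
  have hcob : ∀ g x y, signChar (Q g (x + y)) = signChar (Q g x) * signChar (Q g y) *
      (signChar (C x y) * signChar (C (g.1 x) (g.1 y))) := by
    intro g x y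
    rw [hQ, AddChar.map_add_eq_mul, AddChar.map_add_eq_mul, AddChar.map_add_eq_mul]
  refine ⟨⟨_, hbi, hself, ⟨fun g x => signChar (Q g x), fun g x y => ?_, fun x => ?_⟩, fun g => ?_⟩⟩
  · change traceChar k (b (g.1 x) (g.1 y)) * _ = traceChar k (b x y) * _
    rw [hC, hC, hcob]
    have h := signChar_sq (C x y)
    calc _ = signChar (C x y) ^ 2 * (signChar (C (g.1 x) (g.1 y)) *
          (signChar (Q g x) * signChar (Q g y))) := by rw [h, one_mul]
      _ = _ := by rw [_root_.sq]; simp only [mul_comm, mul_left_comm]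
  · simp [hQ1 1 rfl]
  · have hd : ∀ x y, signChar (Q g x) * signChar (Q g y) / signChar (Q g (x + y)) =
        signChar (C x y + C (g.1 x) (g.1 y)) := by
      intro x y
      rw [hcob, AddChar.map_add_eq_mul, div_mul_cancel_left, mul_inv, signChar_inv, signChar_inv]
    have h0 : Q g 0 = 0 := by
      have h := hQ g 0 0
      simpa using h
    refine ⟨by simp [h0], fun x => signChar_sq _, ⟨fun x y z => ?_, fun x y z => ?_⟩, fun x => ?_⟩
    · simp only [hd]
      rw [← AddChar.map_add_eq_mul]
      simp only [map_add, LinearMap.add_apply]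
      congr 1
      ring
    · simp only [hd]
      rw [← AddChar.map_add_eq_mul]
      simp only [map_add]
      congr 1
      ring
    · simp [h2V, h0, signChar_sq]

/-- Preserving ω only makes the sum of Tr b(x, y) and Tr b(gx, gy) symmetric, not alternating, so
the cochains may need fourth roots of unity. -/
theorem nonempty_apsData (q : QuadraticForm k V) : Nonempty (APsData (omega q)) := by
  classical
  let _ : Module (ZMod 2) V := AddCommGroup.zmodModule fun x => by
    rw [two_nsmul, ← two_smul k x, CharTwo.two_eq_zero, zero_smul]
  obtain ⟨b, hb⟩ := LinearMap.BilinMap.toQuadraticMap_surjective q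
  obtain ⟨C, hC⟩ := exists_bilinear_traceChar b
  have hbi : IsBicharacter fun x y => traceChar k (b x y) :=
    ⟨fun x y z => by simp [AddChar.map_add_eq_mul], fun x y z => by simp [AddChar.map_add_eq_mul]⟩
  have homega : ∀ x y, omega q x y = signChar (C x y + C y x) := by
    intro x y
    rw [omega, ← hb, LinearMap.BilinMap.polar_toQuadraticMap, AddChar.map_add_eq_mul, hC, hC,
      AddChar.map_add_eq_mul]
  have key : ∀ g : Sp (omega q), ∃ η : V → ℂˣ, (g = 1 → η = 1) ∧
      ∀ x y, signChar (C (g.1 x) (g.1 y)) * (η x * η y) = signChar (C x y) * η (x + y) := by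
    intro g
    by_cases hg : g = 1
    · subst hg
      exact ⟨1, fun _ => rfl, fun x y => by simp⟩
    · let G : V →ₗ[ZMod 2] V := AddMonoidHom.toZModLinearMap 2 g.1.toLinearMap.toAddMonoidHom
      obtain ⟨η, hη⟩ := exists_coboundary_of_symmetric (C + C.compl₁₂ G G) (by
        intro x y
        have h1 : C (g.1 x) (g.1 y) + C (g.1 y) (g.1 x) = C x y + C y x := signChar_injective (by
          rw [← homega, ← homega]
          exact g.2 x y)
        change C x y + C (g.1 x) (g.1 y) = C y x + C (g.1 y) (g.1 x)
        linear_combination h1 - CharTwo.add_self_eq_zero (C (g.1 y) (g.1 x)) +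
          CharTwo.add_self_eq_zero (C x y))
      refine ⟨η, fun h => absurd h hg, fun x y => ?_⟩
      have h2 : η x * η y = signChar (C x y) * signChar (C (g.1 x) (g.1 y)) * η (x + y) := by
        rw [hη, ← AddChar.map_add_eq_mul]
        rfl
      rw [h2, ← mul_assoc, mul_left_comm, ← _root_.sq, signChar_sq, mul_one]
  choose η hη1 hη using key
  refine ⟨⟨hbi.toCocycle, fun x y => ?_, ⟨η, fun g x y => ?_, fun x => ?_⟩⟩⟩
  · change traceChar k (b x y) / traceChar k (b y x) = _
    rw [homega, hC, hC, AddChar.map_add_eq_mul, div_eq_mul_inv, signChar_inv]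
  · change traceChar k (b (g.1 x) (g.1 y)) * _ = traceChar k (b x y) * _
    rw [hC, hC, hη]
  · rw [hη1 1 rfl, Pi.one_apply]

end ExistenceData

/-! ### Nonsplitting -/

section Nonsplitting

variable {k V Y : Type*} [Field k] [Finite k] [CharP k 2] [AddCommGroup V] [Module k V] [Group Y]
  {q : QuadraticForm k V} {α : Cocycle V}

/-- If a faithful representation of `Y` contains all Siegel transformations, then there is no
multiplicative family `u_x ↦ ζ_g(x) u_{g x}`, `g ∈ Y`, of automorphisms of `ℂ_α[V]`. -/
theorem not_exists_cochain_of_finrank (hq : (polarBilin q).Nondegenerate)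
    (hdim : 8 ≤ Module.finrank k V) (ρ : Y →* (V ≃ₗ[k] V)) (hinj : Function.Injective ρ)
    (hα : ∀ x y, α.alt x y = omega q x y)
    (hρ : ∀ (u w : V) (hu : q u = 0) (huw : polar q u w = 0), ∃ g, ρ g = siegel hu huw) :
    ¬ ∃ ζ : Y → V → ℂˣ,
      (∀ g x y, α (ρ g x) (ρ g y) * (ζ g x * ζ g y) = α x y * ζ g (x + y)) ∧
      ∀ g h x, ζ (g * h) x = ζ g (ρ h x) * ζ h x := by
  rintro ⟨ζ, hζ, hmul⟩
  have : FiniteDimensional k V := Module.finite_of_finrank_pos (by omega)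
  obtain ⟨u, -, v, -, hu, -, huv, P, -, huP, hvP, hP, hPdim⟩ := exists_hyperbolic_pair q ⊤
    (fun x _ h => hq.1 x fun y => h y trivial) (by rw [finrank_top]; omega)
  rw [finrank_top] at hPdim
  obtain ⟨e, heP, f, hfP, he, hf, hef, P', hP'le, heP', hfP', hP', hP'dim⟩ :=
    exists_hyperbolic_pair q P hP (by omega)
  obtain ⟨e', he'P', f', hf'P', he', hf', hef', P'', hP''le, he'P'', hf'P'', hP'', hP''dim⟩ :=
    exists_hyperbolic_pair q P' hP' (by omega)
  -- Three planes use at most six of the eight dimensions; nondegeneracy on what remains gives the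
  -- pair (x, z).
  have : Nontrivial P'' := Module.nontrivial_of_finrank_pos (R := k) (by omega)
  obtain ⟨⟨z, hz⟩, hz0⟩ := exists_ne (0 : P'')
  obtain ⟨x, hx, hzx⟩ : ∃ x ∈ P'', polar q z x ≠ 0 := by
    by_contra! h
    exact hz0 (Subtype.ext (hP'' z hz h))
  let _ := ZMod.algebra k 2
  -- The trace of a finite field is onto 𝔽₂, which provides the value c of q(w) with nontrivial
  -- character.
  obtain ⟨c, hc⟩ := Algebra.trace_surjective (ZMod 2) k 1
  refine not_exists_cochain hinj hα hζ hmul hρ (x := (polar q z x)⁻¹ • x) (z := z) hu huv he hf hef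
    he' hf' hef' ?_ ?_ ?_ ?_ ?_ ?_ ?_ c ?_
  · rw [polar_smul_right, smul_eq_mul, inv_mul_cancel₀ hzx]
  · simpa using ⟨huP e heP, huP f hfP, huP e' (hP'le he'P'), huP f' (hP'le hf'P'),
      .inr (huP x (hP'le (hP''le hx))), huP z (hP'le (hP''le hz))⟩
  · simpa using ⟨hvP e heP, hvP f hfP, hvP e' (hP'le he'P'), hvP f' (hP'le hf'P')⟩
  · simpa using ⟨heP' e' he'P', heP' f' hf'P', .inr (heP' x (hP''le hx)), heP' z (hP''le hz)⟩
  · simpa using ⟨hfP' e' he'P', hfP' f' hf'P', .inr (hfP' x (hP''le hx)), hfP' z (hP''le hz)⟩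
  · simpa using ⟨.inr (he'P'' x hx), he'P'' z hz⟩
  · simpa using ⟨.inr (hf'P'' x hx), hf'P'' z hz⟩
  · rw [Ne, traceChar_eq_one_iff, hc]
    exact one_ne_zero

end Nonsplitting

end PseudoSymplectic

theorem mainTheorem8 {k V : Type*} [Field k] [Finite k] [CharP k 2] [AddCommGroup V] [Module k V]
    (q : QuadraticForm k V) (hq : (QuadraticMap.polarBilin q).Nondegenerate)
    (n : ℕ) (hn : 4 ≤ n) (hdim : Module.finrank k V = 2 * n) :
    (Nonempty (PseudoSymplectic.APsData (PseudoSymplectic.omega q)) ∧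
      Nonempty (PseudoSymplectic.PsData 2 (PseudoSymplectic.qHat q))) ∧
    (∀ D : PseudoSymplectic.APsData (PseudoSymplectic.omega q),
      IsEmpty (PseudoSymplectic.apsSystem hq D).extension.Splitting) ∧
    (∀ D : PseudoSymplectic.PsData 2 (PseudoSymplectic.qHat q),
      IsEmpty (PseudoSymplectic.psSystem hq D).extension.Splitting) ∧
    (∀ D : PseudoSymplectic.PsData 2 (PseudoSymplectic.qHat q),
      IsEmpty (PseudoSymplectic.omegaSystem hq D).extension.Splitting) := by
  have h8 : 8 ≤ Module.finrank k V := by omega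
  refine ⟨⟨PseudoSymplectic.nonempty_apsData q, PseudoSymplectic.nonempty_psData q⟩,
    fun D => ⟨fun s => ?_⟩, fun D => ⟨fun s => ?_⟩, fun D => ⟨fun s => ?_⟩⟩
  · exact PseudoSymplectic.not_exists_cochain_of_finrank hq h8 (PseudoSymplectic.SpLin q).subtype
      Subtype.val_injective D.alt_eq
      (fun u w hu huw => ⟨⟨PseudoSymplectic.siegel hu huw, PseudoSymplectic.polar_map
        (PseudoSymplectic.siegel_mem_orthLin hu huw)⟩, rfl⟩)
      (D.lifts.exists_cochain_of_splitting (D.nondegenerate hq) (PseudoSymplectic.spIncl q) s)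
  · exact PseudoSymplectic.not_exists_cochain_of_finrank hq h8 (PseudoSymplectic.OrthLin q).subtype
      Subtype.val_injective D.alt_eq
      (fun u w hu huw => ⟨⟨_, PseudoSymplectic.siegel_mem_orthLin hu huw⟩, rfl⟩)
      (D.lifts.exists_cochain_of_splitting (D.nondegenerate hq) (PseudoSymplectic.orthIncl q) s)
  · exact PseudoSymplectic.not_exists_cochain_of_finrank hq h8
      ((PseudoSymplectic.OrthLin q).subtype.comp (PseudoSymplectic.OmegaLin q).subtype)
      (Subtype.val_injective.comp Subtype.val_injective) D.alt_eq
      (fun u w hu huw => ⟨⟨_, PseudoSymplectic.siegel_mem_omegaLin hu huw⟩, rfl⟩)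
      (D.lifts.exists_cochain_of_splitting (D.nondegenerate hq)
        ((PseudoSymplectic.orthIncl q).comp (PseudoSymplectic.OmegaLin q).subtype) s)
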